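/- Let $F$ be an arbitrary field; algebras are associative unital $F$-algebras, and subalgebras contain the unit of the algebra. A unital algebra $A$ is a locally matrix algebra if every finite set of elements of $A$ lies in a subalgebra isomorphic to a matrix algebra $M_n(F)$, $n\ge 1$. A Steinitz number is a formal product $\prod_p p^{r_p}$ over all primes $p$ with $r_p\in\{0,1,2,\dots\}\cup\{\infty\}$; it is infinite if it is not a positive integer. The Steinitz number $\mathbf{st}(A)$ of a unital locally matrix algebra $A$ is the least common multiple of all positive integers $n$ such that $A$ has a subalgebra isomorphic to $M_n(F)$. The tensor product $\bigotimes_{i\in I}A_i$ of a (finite or infinite) family of unital algebras is the direct limit of the tensor products of its finite subfamilies, i.e. it is spanned by the tensors $\otimes_i a_i$ with $a_i=1$ for all but finitely many $i$. For every infinite Steinitz number $s$ there exists a unital locally matrix algebra $A$ over $F$ such that $\mathbf{st}(A)=s$ and $A$ is not isomorphic to a tensor product $\bigotimes_{i\in I}M_{n_i}(F)$, $n_i\ge 1$, of any (finite or infinite) family of matrix algebras. -/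

import Mathlib

universe u v w

/-- A Steinitz (supernatural) number `∏ p ^ r_p` is given by its exponents `r_p ∈ ℕ ∪ {∞}`, one for
each prime `p`.  The pointwise order is divisibility, and pointwise suprema are least common
multiples. -/
abbrev SteinitzNumber : Type := Nat.Primes → ℕ∞

namespace SteinitzNumber

/-- The Steinitz number of a positive integer, that is, its prime factorization. -/
def ofNat (n : ℕ) : SteinitzNumber := fun p => (n.factorization (p : ℕ) : ℕ∞)

/-- A Steinitz number is infinite if it is not a positive integer. -/
def IsInfinite (s : SteinitzNumber) : Prop := ∀ n : ℕ, 0 < n → s ≠ ofNat n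

end SteinitzNumber

/-- A unital algebra is a locally matrix algebra if every finite collection of its elements lies in
a subalgebra with the same unit that is isomorphic to some `M_n(F)`, `n ≥ 1`. -/
def IsLocallyMatrixAlgebra (F : Type u) (A : Type w) [Field F] [Ring A] [Algebra F A] : Prop :=
  ∀ S : Finset A, ∃ B : Subalgebra F A, (∀ a ∈ S, a ∈ B) ∧
    ∃ n : ℕ, 0 < n ∧ Nonempty (B ≃ₐ[F] Matrix (Fin n) (Fin n) F)

/-- The set `D(A)` of all `n ≥ 1` such that `A` has a subalgebra, with the same unit, isomorphic
to `M_n(F)`. -/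
def matrixDegrees (F : Type u) (A : Type w) [Field F] [Ring A] [Algebra F A] : Set ℕ :=
  {n | 0 < n ∧ ∃ B : Subalgebra F A, Nonempty (B ≃ₐ[F] Matrix (Fin n) (Fin n) F)}

/-- The Steinitz number `st(A)`: the least common multiple of `D(A)`. -/
noncomputable def steinitzNumberOf (F : Type u) (A : Type w) [Field F] [Ring A] [Algebra F A] :
    SteinitzNumber :=
  sSup (SteinitzNumber.ofNat '' matrixDegrees F A)

open scoped TensorProduct Classical in
/-- The (possibly infinite) tensor product of a family of unital algebras over a field: the
algebra spanned by the pure tensors all but finitely many of whose entries are `1`.  It is the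
subalgebra of the full tensor product of the family that is generated by the images of the factors
under `a ↦ 1 ⊗ ⋯ ⊗ a ⊗ 1 ⊗ ⋯`.  Over a field the finite tensor products of factors embed into the
full tensor product, so this is also the direct limit of the finite tensor products. -/
noncomputable def algebraTensorProduct (F : Type u) [Field F] {ι : Type v} (B : ι → Type w)
    [∀ i, Ring (B i)] [∀ i, Algebra F (B i)] : Subalgebra F (⨂[F] i, B i) :=
  ⨆ i, (PiTensorProduct.singleAlgHom (R := F) (A := B) i).range

/-!
The algebra is a maximal locally matrix subalgebra `A` of `End V` with Steinitz number `s`, where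
`V` has a basis indexed by `ℕ`, among those containing a fixed countably generated one, `A₀`.

For every positive integer `n` dividing `s`, `M_n(F)` acts on `V` by block diagonal operators with
equal blocks of length `n`; the union of these algebras over all `n` is `A₀` (`blockAlgebra`).  It
has Steinitz number `s`, and since `s` is infinite, only scalars commute with it
(`mem_bot_of_commute_blockAlgebra`) and each finite set of vectors is killed by a nonzero element of
it (`hasAnnihilators_blockAlgebra`).  Zorn's lemma provides `A`.

The main point is that `A` is not countably generated.  Otherwise `A` is the union of a chain of
matrix subalgebras `B k`.  Choose units `u (k + 1)` of `A` that centralize `B k` and fix more and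
more vectors (`exists_unit_conj_notMem`).  The products `u 1 * ⋯ * u k` converge pointwise to an
invertible operator `g` with `g * A * g⁻¹ ≤ A`, and the `u k` can be chosen so that the inclusion is
proper (`exists_conj_gt`).  Then `g⁻¹ * A * g` is a larger locally matrix algebra with the same
Steinitz number, contradicting maximality.

Finally, suppose that `A` is a tensor product of matrix algebras (or just generated by commuting
matrix subalgebras).  As `A₀` is countably generated, it lies in the product of countably many of
the factors; every other factor centralizes `A₀`, hence consists of scalars.  So countably many
factors generate `A`, which is impossible (`isEmpty_algEquiv_iSup_range_of_maximal`).
-/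

/-! ### Matrix units and centralizers -/

section MatrixUnits

open Matrix

variable {F : Type u} [Field F] {U : Type w} [Ring U] [Algebra F U]

/-- The `(i, j)` coefficient of `x` with respect to the matrix units `e k l = f (single k l 1)`,
namely `∑ k, e k i * x * e j k`.  It centralizes the image of `f`, and `x` is recovered as
`∑ i j, matrixCoeff f i j x * e i j`. -/
def matrixCoeff {n : ℕ} (f : Matrix (Fin n) (Fin n) F →ₐ[F] U) (i j : Fin n) (x : U) : U :=
  ∑ k, f (single k i 1) * x * f (single j k 1)

/-- A subalgebra is a matrix subalgebra if it is the image of a unital homomorphism from some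
`M_n(F)`, `n ≥ 1`; such a homomorphism is injective when the ambient algebra is nontrivial. -/
def IsMatrixSubalgebra (B : Subalgebra F U) : Prop :=
  ∃ n : ℕ, 0 < n ∧ ∃ f : Matrix (Fin n) (Fin n) F →ₐ[F] U, f.range = B

/-- Every finite subset of `A` lies in a matrix subalgebra contained in `A`. -/
def IsLocallyMatrix (A : Subalgebra F U) : Prop :=
  ∀ S : Finset U, (S : Set U) ⊆ A → ∃ B, IsMatrixSubalgebra B ∧ (S : Set U) ⊆ B ∧ B ≤ A

variable {n : ℕ} (f : Matrix (Fin n) (Fin n) F →ₐ[F] U)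

lemma unit_mul_unit_of_ne {i j k l : Fin n} (h : j ≠ k) :
    f (single i j 1) * f (single k l 1) = 0 := by
  rw [← map_mul, single_mul_single_of_ne _ _ _ _ h, map_zero]

lemma unit_mul_unit_same (i j l : Fin n) :
    f (single i j 1) * f (single j l 1) = f (single i l 1) := by
  rw [← map_mul, single_mul_single_same, one_mul]

lemma sum_units_eq_one : ∑ i, f (single i i 1) = 1 := by
  rw [← map_sum, sum_single_one, map_one]

lemma map_eq_sum_units (M : Matrix (Fin n) (Fin n) F) :
    f M = ∑ i, ∑ j, M i j • f (single i j 1) := by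
  conv_lhs => rw [matrix_eq_sum_single M]
  simp only [map_sum]
  refine Finset.sum_congr rfl fun i _ => Finset.sum_congr rfl fun j _ => ?_
  rw [← map_smul, smul_single, smul_eq_mul, mul_one]

lemma unit_mul_matrixCoeff (a b i j : Fin n) (x : U) :
    f (single a b 1) * matrixCoeff f i j x = f (single a i 1) * x * f (single j b 1) := by
  rw [matrixCoeff, Finset.mul_sum, Finset.sum_eq_single b]
  · rw [← mul_assoc, ← mul_assoc, unit_mul_unit_same]
  · intro k _ hk
    rw [← mul_assoc, ← mul_assoc, unit_mul_unit_of_ne f hk.symm, zero_mul, zero_mul]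
  · simp

lemma matrixCoeff_mul_unit (a b i j : Fin n) (x : U) :
    matrixCoeff f i j x * f (single a b 1) = f (single a i 1) * x * f (single j b 1) := by
  rw [matrixCoeff, Finset.sum_mul, Finset.sum_eq_single a]
  · rw [mul_assoc, unit_mul_unit_same]
  · intro k _ hk
    rw [mul_assoc, unit_mul_unit_of_ne f hk, mul_zero]
  · simp

lemma commute_map_of_commute_units {x : U} (h : ∀ a b, Commute x (f (single a b 1)))
    (M : Matrix (Fin n) (Fin n) F) : Commute x (f M) := by
  rw [map_eq_sum_units]
  exact Commute.sum_right _ _ _ fun i _ => Commute.sum_right _ _ _ fun j _ =>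
    (h i j).smul_right _

lemma commute_matrixCoeff (i j : Fin n) (x : U) (M : Matrix (Fin n) (Fin n) F) :
    Commute (matrixCoeff f i j x) (f M) :=
  commute_map_of_commute_units f
    (fun a b => (matrixCoeff_mul_unit f a b i j x).trans (unit_mul_matrixCoeff f a b i j x).symm) M

lemma sum_matrixCoeff_mul_unit (x : U) :
    ∑ i, ∑ j, matrixCoeff f i j x * f (single i j 1) = x := by
  simp only [matrixCoeff_mul_unit]
  simp_rw [← Finset.mul_sum, ← Finset.sum_mul, sum_units_eq_one, one_mul, mul_one]

lemma matrixCoeff_map (i j : Fin n) (M : Matrix (Fin n) (Fin n) F) :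
    matrixCoeff f i j (f M) = M i j • (1 : U) := by
  have : ∀ k, f (single k i 1) * f M * f (single j k 1) = M i j • f (single k k 1) := by
    intro k
    rw [← map_mul, ← map_mul, single_mul_mul_single, ← map_smul, smul_single]
    simp
  simp only [matrixCoeff, this, ← Finset.smul_sum, sum_units_eq_one]

lemma matrixCoeff_mul_of_commute {t : U} (ht : ∀ M, Commute t (f M)) (i j : Fin n) (x : U) :
    matrixCoeff f i j (x * t) = matrixCoeff f i j x * t := by
  rw [matrixCoeff, matrixCoeff, Finset.sum_mul]
  refine Finset.sum_congr rfl fun k _ => ?_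
  rw [mul_assoc, mul_assoc, (ht _).eq, mul_assoc, mul_assoc]

lemma matrixCoeff_mem {A : Subalgebra F U} (hf : f.range ≤ A) (i j : Fin n) {x : U} (hx : x ∈ A) :
    matrixCoeff f i j x ∈ A :=
  sum_mem fun _ _ => mul_mem (mul_mem (hf ⟨_, rfl⟩) hx) (hf ⟨_, rfl⟩)

lemma exists_matrixCoeff_ne_zero {x : U} (hx : x ≠ 0) : ∃ i j, matrixCoeff f i j x ≠ 0 := by
  by_contra! h
  apply hx
  rw [← sum_matrixCoeff_mul_unit f x]
  simp [h]

/-- Double centralizer theorem for a matrix subalgebra of an algebra with centre `F`. -/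
lemma mem_range_of_commute_centralizer {A : Subalgebra F U} (hf : f.range ≤ A)
    (hZ : ∀ z ∈ A, (∀ a ∈ A, Commute z a) → z ∈ (⊥ : Subalgebra F U)) {y : U} (hy : y ∈ A)
    (h : ∀ c ∈ A, (∀ M, Commute c (f M)) → Commute c y) : y ∈ f.range := by
  rw [← sum_matrixCoeff_mul_unit f y]
  refine sum_mem fun i _ => sum_mem fun j _ => mul_mem ?_ ⟨_, rfl⟩
  refine bot_le (a := f.range) (hZ _ (matrixCoeff_mem f hf i j hy) fun a ha => ?_)
  rw [← sum_matrixCoeff_mul_unit f a]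
  refine Commute.sum_right _ _ _ fun k _ => Commute.sum_right _ _ _ fun l _ =>
    Commute.mul_right ?_ (commute_matrixCoeff f i j y _)
  have h1 : ∀ M, Commute (matrixCoeff f k l a) (f M) := commute_matrixCoeff f k l a
  have h2 := h _ (matrixCoeff_mem f hf k l ha) h1
  exact (Commute.sum_right _ _ _ fun m _ => ((h1 _).mul_right h2).mul_right (h1 _)).symm

/-- `F`-linear independence of the centralizer over a matrix subalgebra: if `x ≠ 0` and `x * t` lie
in the matrix subalgebra and `t` centralizes it, then `t` lies in it. -/
lemma mem_range_of_mul_mem_range {x t : U} (hx : x ∈ f.range) (hx0 : x ≠ 0)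
    (ht : ∀ M, Commute t (f M)) (hxt : x * t ∈ f.range) : t ∈ f.range := by
  obtain ⟨M, rfl⟩ := hx
  have hM : M ≠ 0 := by rintro rfl; simp at hx0
  obtain ⟨i, j, hij⟩ : ∃ i j, M i j ≠ 0 := by
    by_contra! h
    exact hM (by ext i j; exact h i j)
  have h1 := matrixCoeff_mul_of_commute f ht i j (f M)
  have h2 : matrixCoeff f i j (f M * t) ∈ f.range := matrixCoeff_mem f le_rfl i j hxt
  have h3 := matrixCoeff_map f i j M
  simp only [RingHom.coe_coe, AlgHom.toRingHom_eq_coe] at *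
  rw [h1, h3, smul_mul_assoc, one_mul] at h2
  have h4 := f.range.smul_mem h2 (M i j)⁻¹
  rwa [smul_smul, inv_mul_cancel₀ hij, one_smul] at h4

lemma eq_zero_of_mul_eq_zero_of_commute {x t : U} (hx : x ∈ f.range) (hx0 : x ≠ 0)
    (ht : ∀ M, Commute t (f M)) (hxt : x * t = 0) : t = 0 := by
  obtain ⟨M, rfl⟩ := hx
  have hM : M ≠ 0 := by rintro rfl; simp at hx0
  obtain ⟨i, j, hij⟩ : ∃ i j, M i j ≠ 0 := by
    by_contra! h
    exact hM (by ext i j; exact h i j)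
  have h1 := matrixCoeff_mul_of_commute f ht i j (f M)
  have h3 := matrixCoeff_map f i j M
  simp only [RingHom.coe_coe, AlgHom.toRingHom_eq_coe] at *
  rw [hxt, h3, smul_mul_assoc, one_mul] at h1
  have : M i j • t = 0 := by rw [← h1]; simp [matrixCoeff]
  exact (smul_eq_zero_iff_right hij).1 this

/-- A scalar in the image of a matrix algebra with zero square vanishes. -/
lemma eq_zero_of_mem_range_of_sq_eq_zero {t : U} (ht : t ∈ f.range)
    (hc : ∀ M, Commute t (f M)) (h : t * t = 0) : t = 0 := by
  by_contra h0
  exact h0 (eq_zero_of_mul_eq_zero_of_commute f ht h0 hc h)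

/-- A locally matrix algebra is a prime ring. -/
lemma IsLocallyMatrix.eq_zero_or_eq_zero {A : Subalgebra F U} (hA : IsLocallyMatrix A) {a b : U}
    (ha : a ∈ A) (hb : b ∈ A) (h : ∀ x ∈ A, a * x * b = 0) : a = 0 ∨ b = 0 := by
  classical
  obtain ⟨_, ⟨n, hn, f, rfl⟩, hS, hBA⟩ := hA {a, b} (by
    intro x hx
    simp only [Finset.coe_insert, Finset.coe_singleton, Set.mem_insert_iff,
      Set.mem_singleton_iff] at hx
    rcases hx with rfl | rfl <;> assumption)
  have ha' : a ∈ f.range := hS (by simp)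
  have hb' : b ∈ f.range := hS (by simp)
  by_contra! hab
  -- Some coefficient of `b` is nonzero; it centralizes `a`, and `a` annihilates it.
  obtain ⟨i, j, hij⟩ := exists_matrixCoeff_ne_zero f hab.2
  apply hij
  refine eq_zero_of_mul_eq_zero_of_commute f ha' hab.1 (commute_matrixCoeff f i j b) ?_
  rw [matrixCoeff, Finset.mul_sum]
  refine Finset.sum_eq_zero fun k _ => ?_
  rw [← mul_assoc, ← mul_assoc, h _ (hBA (f.mem_range_self _)), zero_mul]

/-- The centralizer of a matrix subalgebra in a locally matrix algebra is a prime ring. -/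
lemma IsLocallyMatrix.centralizer_eq_zero_or_eq_zero {A : Subalgebra F U}
    (hA : IsLocallyMatrix A) (hf : f.range ≤ A) {a b : U} (ha : a ∈ A) (hb : b ∈ A)
    (hbf : ∀ M, Commute b (f M))
    (h : ∀ x ∈ A, (∀ M, Commute x (f M)) → a * x * b = 0) : a = 0 ∨ b = 0 := by
  refine hA.eq_zero_or_eq_zero ha hb fun x hx => ?_
  rw [← sum_matrixCoeff_mul_unit f x]
  simp only [Finset.mul_sum, Finset.sum_mul]
  refine Finset.sum_eq_zero fun i _ => Finset.sum_eq_zero fun j _ => ?_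
  rw [mul_assoc, mul_assoc, ← (hbf _).eq, ← mul_assoc, ← mul_assoc,
    h _ (matrixCoeff_mem f hf i j hx) (commute_matrixCoeff f i j x), zero_mul]

/-- If the centralizer of a matrix subalgebra in a locally matrix algebra is not a division ring,
then it contains a nonzero element of square zero: otherwise it would be a reduced prime ring,
hence a domain, and an algebraic domain is a division ring. -/
lemma IsLocallyMatrix.exists_sq_eq_zero {A : Subalgebra F U} (hA : IsLocallyMatrix A)
    (hf : f.range ≤ A) {t : U} (ht : t ∈ A) (htf : ∀ M, Commute t (f M)) (ht0 : t ≠ 0)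
    (htu : ¬ IsUnit t) : ∃ c ∈ A, (∀ M, Commute c (f M)) ∧ c ≠ 0 ∧ c * c = 0 := by
  classical
  by_contra! hred
  let C : Subalgebra F U := A ⊓ Subalgebra.centralizer F (f.range : Set U)
  have hC : ∀ {x : U}, x ∈ C ↔ x ∈ A ∧ ∀ M, Commute x (f M) := by
    intro x
    refine and_congr_right fun _ => ?_
    rw [SetLike.mem_coe, Subalgebra.mem_centralizer_iff]
    exact ⟨fun h M => (h _ ⟨M, rfl⟩).symm, fun h => by rintro _ ⟨M, rfl⟩; exact (h M).symm⟩
  have hdom : ∀ a ∈ C, ∀ b ∈ C, a * b = 0 → a = 0 ∨ b = 0 := by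
    intro a ha b hb hab
    refine (hA.centralizer_eq_zero_or_eq_zero f hf (hC.1 hb).1 (hC.1 ha).1 (hC.1 ha).2
      fun x hx hxf => ?_).symm
    by_contra h0
    have hm : b * x * a ∈ C := mul_mem (mul_mem hb (hC.2 ⟨hx, hxf⟩)) ha
    refine hred _ (hC.1 hm).1 (hC.1 hm).2 h0 ?_
    rw [show b * x * a * (b * x * a) = b * x * (a * b) * (x * a) by simp only [mul_assoc], hab]
    simp
  have : Nontrivial U := ⟨t, 0, ht0⟩
  have : NoZeroDivisors C := ⟨fun {a b} hab => by
    have := hdom a a.2 b b.2 (by simpa using congrArg Subtype.val hab)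
    simpa using this⟩
  have : IsDomain C := NoZeroDivisors.to_isDomain C
  let t' : C := ⟨t, hC.2 ⟨ht, htf⟩⟩
  have hint : IsIntegral F t := by
    obtain ⟨_, ⟨m, hm, g, rfl⟩, hS, -⟩ := hA {t} (by simpa using ht)
    obtain ⟨M, hM⟩ : t ∈ g.range := hS (by simp)
    rw [← hM]
    exact (Algebra.IsIntegral.isIntegral (R := F) M).map g
  have hint' : IsIntegral F t' :=
    (isIntegral_algHom_iff C.val Subtype.val_injective (x := t')).1 hint
  have hu : IsUnit t' := hint'.isUnit (fun h => ht0 (congrArg Subtype.val h))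
  exact htu (hu.map C.val)

end MatrixUnits

/-! ### Units that move a given element away from a matrix subalgebra -/

section Perturbation

open Matrix

variable {F : Type u} [Field F] {U : Type w} [Ring U] [Algebra F U]

lemma IsLocallyMatrix.exists_ge {A B : Subalgebra F U} (hA : IsLocallyMatrix A)
    (hB : IsMatrixSubalgebra B) (hBA : B ≤ A) (S : Finset U) (hS : (S : Set U) ⊆ A) :
    ∃ B', IsMatrixSubalgebra B' ∧ B ≤ B' ∧ (S : Set U) ⊆ B' ∧ B' ≤ A := by
  classical
  obtain ⟨n, hn, f, rfl⟩ := hB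
  obtain ⟨B', hB', hSB', hB'A⟩ := hA
    (S ∪ Finset.univ.image fun p : Fin n × Fin n => f (single p.1 p.2 1)) (by
      intro x hx
      simp only [Finset.coe_union, Set.mem_union, Finset.coe_image, Set.mem_image] at hx
      rcases hx with hx | ⟨p, -, rfl⟩
      · exact hS hx
      · exact hBA (f.mem_range_self _))
  refine ⟨B', hB', ?_, fun x hx => hSB' (by simp [Finset.mem_coe.1 hx]), hB'A⟩
  rintro _ ⟨M, rfl⟩
  simp only [RingHom.coe_coe, AlgHom.toRingHom_eq_coe]
  rw [map_eq_sum_units]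
  refine sum_mem fun i _ => sum_mem fun j _ => B'.smul_mem (hSB' ?_) _
  simp only [Finset.coe_union, Finset.coe_image, Finset.coe_univ, Set.image_univ]
  exact Or.inr ⟨(i, j), rfl⟩

variable {V : Type w} [AddCommGroup V] [Module F V]

/-- A subalgebra of `End V` has annihilating elements if every finite subset of `V` is killed by
some nonzero element of it. -/
def HasAnnihilators (A : Subalgebra F (Module.End F V)) : Prop :=
  ∀ W : Finset V, ∃ a ∈ A, a ≠ 0 ∧ ∀ v ∈ W, a v = 0

lemma HasAnnihilators.exists_commute {A : Subalgebra F (Module.End F V)} (hA : HasAnnihilators A)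
    {n : ℕ} (f : Matrix (Fin n) (Fin n) F →ₐ[F] Module.End F V) (hf : f.range ≤ A)
    (W : Finset V) :
    ∃ t ∈ A, (∀ M, Commute t (f M)) ∧ t ≠ 0 ∧ ∀ v ∈ W, t v = 0 := by
  classical
  obtain ⟨a, ha, ha0, haW⟩ := hA
    ((Finset.univ ×ˢ W).image fun p : (Fin n × Fin n) × V => f (single p.1.1 p.1.2 1) p.2)
  obtain ⟨i, j, hij⟩ := exists_matrixCoeff_ne_zero f ha0
  refine ⟨_, matrixCoeff_mem f hf i j ha, commute_matrixCoeff f i j a, hij, fun v hv => ?_⟩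
  rw [matrixCoeff, LinearMap.sum_apply]
  refine Finset.sum_eq_zero fun k _ => ?_
  rw [Module.End.mul_apply, Module.End.mul_apply,
    haW _ (Finset.mem_image.2 ⟨((j, k), v), by simp [hv], rfl⟩), map_zero]

lemma HasAnnihilators.exists_sq_eq_zero [Nontrivial V] {A : Subalgebra F (Module.End F V)}
    (hA : IsLocallyMatrix A) (hA' : HasAnnihilators A) {n : ℕ} (hn : 0 < n)
    (f : Matrix (Fin n) (Fin n) F →ₐ[F] Module.End F V) (hf : f.range ≤ A) (W : Finset V) :
    ∃ t ∈ A, (∀ M, Commute t (f M)) ∧ t ≠ 0 ∧ t * t = 0 ∧ ∀ v ∈ W, t v = 0 := by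
  obtain ⟨v₀, hv₀⟩ := exists_ne (0 : V)
  obtain ⟨t₀, ht₀, ht₀f, ht₀0, ht₀v⟩ := hA'.exists_commute f hf {v₀}
  have htu : ¬ IsUnit t₀ := by
    rintro ⟨u, rfl⟩
    apply hv₀
    have : (↑u⁻¹ * (u : Module.End F V)) v₀ = v₀ := by rw [u.inv_mul]; rfl
    rw [← this, Module.End.mul_apply, ht₀v _ (by simp), map_zero]
  obtain ⟨c, hc, hcf, hc0, hcc⟩ := hA.exists_sq_eq_zero f hf ht₀ ht₀f ht₀0 htu
  obtain ⟨_, ⟨m, hm, g, rfl⟩, hfg, hcg, hgA⟩ := hA.exists_ge ⟨n, hn, f, rfl⟩ hf {c} (by simpa)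
  obtain ⟨t, ht, htg, ht0, htW⟩ := hA'.exists_commute g hgA W
  have hc' : c ∈ g.range := hcg (by simp)
  have htg' : ∀ x ∈ g.range, Commute t x := by rintro _ ⟨M, rfl⟩; exact htg M
  refine ⟨c * t, mul_mem hc ht, fun M => (hcf M).mul_left (htg' _ (hfg (f.mem_range_self M))),
    fun h => ht0 (eq_zero_of_mul_eq_zero_of_commute g hc' hc0 htg h), ?_, fun v hv => ?_⟩
  · rw [(htg' c hc').mul_mul_mul_comm, hcc, zero_mul]
  · rw [Module.End.mul_apply, htW v hv, map_zero]

/-- Given matrix subalgebras `B, B' ≤ A` and `y ∈ A` outside `B`, some unit of `A` that centralizes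
`B` and fixes a given finite set of vectors conjugates `y` out of `B'`.  The unit is `1 + c * t`,
where `c` centralizes `B` but does not commute with `y`, and `t` is a square-zero element that
centralizes `B'`, `y` and `c`; then the conjugate of `y` is `y + (y * c - c * y) * t`. -/
lemma exists_unit_conj_notMem [Nontrivial V] {A B B' : Subalgebra F (Module.End F V)}
    (hA : IsLocallyMatrix A) (hA' : HasAnnihilators A)
    (hZ : ∀ z ∈ A, (∀ a ∈ A, Commute z a) → z ∈ (⊥ : Subalgebra F (Module.End F V)))
    (hB : IsMatrixSubalgebra B) (hBA : B ≤ A) (hB' : IsMatrixSubalgebra B') (hB'A : B' ≤ A)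
    {y : Module.End F V} (hy : y ∈ A) (hyB : y ∉ B) (W : Finset V) :
    ∃ u : (Module.End F V)ˣ, (u : Module.End F V) ∈ A ∧ (↑u⁻¹ : Module.End F V) ∈ A ∧
      (∀ b ∈ B, Commute (u : Module.End F V) b) ∧ (∀ v ∈ W, (u : Module.End F V) v = v) ∧
      ↑u⁻¹ * y * ↑u ∉ B' := by
  classical
  obtain ⟨n, hn, f, rfl⟩ := hB
  obtain ⟨c, hc, hcf, hcy⟩ : ∃ c ∈ A, (∀ M, Commute c (f M)) ∧ ¬ Commute c y := by
    by_contra! h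
    exact hyB (mem_range_of_commute_centralizer f hBA hZ hy h)
  obtain ⟨_, ⟨m, hm, g, rfl⟩, hB'g, hSg, hgA⟩ := hA.exists_ge hB' hB'A {y, c} (by
    intro x hx
    simp only [Finset.coe_insert, Finset.coe_singleton, Set.mem_insert_iff,
      Set.mem_singleton_iff] at hx
    rcases hx with rfl | rfl <;> assumption)
  obtain ⟨_, ⟨m', hm', g', rfl⟩, hgg', hfg', hg'A⟩ := hA.exists_ge ⟨m, hm, g, rfl⟩ hgA
    (Finset.univ.image fun p : Fin n × Fin n => f (single p.1 p.2 1)) (by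
      intro x hx
      simp only [Finset.coe_image, Set.mem_image] at hx
      obtain ⟨p, -, rfl⟩ := hx
      exact hBA (f.mem_range_self _))
  obtain ⟨t, ht, htg', ht0, htt, htW⟩ := hA'.exists_sq_eq_zero hA hm' g' hg'A W
  have hcomm : ∀ x ∈ g'.range, Commute t x := by rintro _ ⟨M, rfl⟩; exact htg' M
  have hyg : y ∈ g.range := hSg (by simp)
  have hcg : c ∈ g.range := hSg (by simp)
  have htc : Commute t c := hcomm c (hgg' hcg)
  have hty : Commute t y := hcomm y (hgg' hyg)
  have htf : ∀ M, Commute t (f M) := commute_map_of_commute_units f fun a b =>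
    hcomm _ (hfg' (by simp))
  have hnn : c * t * (c * t) = 0 := by rw [htc.mul_mul_mul_comm, htt, mul_zero]
  let u : (Module.End F V)ˣ :=
    ⟨1 + c * t, 1 - c * t, by simp [mul_sub, add_mul, hnn], by simp [mul_add, sub_mul, hnn]⟩
  have hu : (u : Module.End F V) = 1 + c * t := rfl
  have hu' : (↑u⁻¹ : Module.End F V) = 1 - c * t := rfl
  refine ⟨u, ?_, ?_, ?_, ?_, fun hmem => ?_⟩
  · exact hu ▸ add_mem (one_mem _) (mul_mem hc ht)
  · exact hu' ▸ sub_mem (one_mem _) (mul_mem hc ht)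
  · rintro _ ⟨M, rfl⟩
    exact (Commute.one_left _).add_left ((hcf M).mul_left (htf M))
  · intro v hv
    rw [hu, LinearMap.add_apply, Module.End.mul_apply, htW v hv, map_zero, add_zero]; rfl
  · have hcalc : ↑u⁻¹ * y * ↑u = y + (y * c - c * y) * t := by
      have h1 : c * t * y * (c * t) = 0 := by
        rw [mul_assoc c t y, hty.eq, ← mul_assoc c y t, mul_assoc, ← mul_assoc t c t, htc.eq,
          mul_assoc c t t, htt, mul_zero, mul_zero]
      have h2 : c * t * y = c * y * t := by rw [mul_assoc, hty.eq, mul_assoc]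
      rw [hu, hu', sub_mul, one_mul, mul_add, mul_one, sub_mul, h1, sub_zero, h2, sub_mul,
        ← mul_assoc]
      abel
    have h3 : (y * c - c * y) * t ∈ g.range := by
      have := sub_mem (hB'g hmem) hyg
      rwa [hcalc, add_sub_cancel_left] at this
    have hcommg : ∀ M, Commute t (g M) := fun M => hcomm _ (hgg' (g.mem_range_self M))
    have h4 : t ∈ g.range := mem_range_of_mul_mem_range g
      (sub_mem (mul_mem hyg hcg) (mul_mem hcg hyg))
      (fun h => hcy (sub_eq_zero.1 h).symm) hcommg h3
    exact ht0 (eq_zero_of_mem_range_of_sq_eq_zero g h4 hcommg htt)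

end Perturbation

/-! ### Enlarging countably generated algebras of operators -/

section Enlarging

open Matrix

variable {F : Type u} [Field F] {V : Type w} [AddCommGroup V] [Module F V]

/-- A sequence of operators whose values on each basis vector are eventually constant has a
pointwise limit. -/
lemma exists_pointwise_limit (δ : Module.Basis ℕ F V) (T : ℕ → Module.End F V)
    (hT : ∀ k, ∀ i ≤ k, T (k + 1) (δ i) = T k (δ i)) :
    ∃ L : Module.End F V, ∀ v, ∃ K, ∀ k ≥ K, T k v = L v := by
  have hst : ∀ i, ∀ k ≥ i, T k (δ i) = T i (δ i) := by
    intro i k hk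
    induction k, hk using Nat.le_induction with
    | base => rfl
    | succ k hk ih => rw [hT k i hk, ih]
  refine ⟨δ.constr F fun i => T i (δ i), fun v => ?_⟩
  have hv : v ∈ Submodule.span F (Set.range δ) := by rw [δ.span_eq]; trivial
  induction hv using Submodule.span_induction with
  | mem v hv =>
    obtain ⟨i, rfl⟩ := hv
    exact ⟨i, fun k hk => by rw [δ.constr_basis, hst i k hk]⟩
  | zero => exact ⟨0, by simp⟩
  | add v w _ _ hv hw =>
    obtain ⟨K, hK⟩ := hv
    obtain ⟨K', hK'⟩ := hw
    exact ⟨max K K', fun k hk => by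
      rw [map_add, map_add, hK k (le_of_max_le_left hk), hK' k (le_of_max_le_right hk)]⟩
  | smul c v _ hv =>
    obtain ⟨K, hK⟩ := hv
    exact ⟨K, fun k hk => by rw [map_smul, map_smul, hK k hk]⟩

/-- A countably generated locally matrix algebra `A` of operators, with trivial centre and with
annihilating elements, is a proper subalgebra of one of its conjugates.  With `A` the union of a
chain of matrix subalgebras `B k` and `y` a nonscalar element of `A`, the conjugating operator is
the pointwise limit `g` of products `u 1 * ⋯ * u k` of units of `A` such that `u (k + 1)`
centralizes `B k`, so that `g * A * g⁻¹ ≤ A`, and such that the `k`-th product conjugates `y` out of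
`B k`, so that `g⁻¹ * y * g` is not in `A`. -/
lemma exists_conj_gt (δ : Module.Basis ℕ F V) {A : Subalgebra F (Module.End F V)}
    (hA : IsLocallyMatrix A) (hA' : HasAnnihilators A)
    (hZ : ∀ z ∈ A, (∀ a ∈ A, Commute z a) → z ∈ (⊥ : Subalgebra F (Module.End F V)))
    (hbot : A ≠ ⊥) (a : ℕ → Module.End F V) (ha : ∀ k, a k ∈ A)
    (hgen : ∀ C : Subalgebra F (Module.End F V), (∀ k, a k ∈ C) → A ≤ C) :
    ∃ e : V ≃ₗ[F] V,
      A < A.map (e.conjAlgEquiv F : Module.End F V →ₐ[F] Module.End F V) := by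
  classical
  obtain ⟨y, hyA, hy⟩ : ∃ y ∈ A, y ∉ (⊥ : Subalgebra F (Module.End F V)) := by
    by_contra! h
    exact hbot (le_bot_iff.1 h)
  have hnt : Nontrivial V := ⟨δ 0, 0, δ.ne_zero 0⟩
  let good : Subalgebra F (Module.End F V) × (Module.End F V)ˣ → Prop := fun p =>
    IsMatrixSubalgebra p.1 ∧ p.1 ≤ A ∧ (p.2 : Module.End F V) ∈ A ∧
      (↑p.2⁻¹ : Module.End F V) ∈ A ∧ ↑p.2⁻¹ * y * ↑p.2 ∉ p.1
  have step : ∀ (k : ℕ) (p : {p // good p}), ∃ q : {p // good p},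
      p.1.1 ≤ q.1.1 ∧ a k ∈ q.1.1 ∧
      (∀ b ∈ p.1.1, (q.1.2 : Module.End F V) * b * ↑q.1.2⁻¹ = ↑p.1.2 * b * ↑p.1.2⁻¹) ∧
      (∀ i ≤ k, (q.1.2 : Module.End F V) (δ i) =
        (p.1.2 : Module.End F V) (δ i)) ∧
      (∀ i ≤ k, (↑q.1.2⁻¹ : Module.End F V) (δ i) =
        (↑p.1.2⁻¹ : Module.End F V) (δ i)) := by
    rintro k ⟨⟨B, g⟩, hB, hBA, hg, hg', hyB⟩
    obtain ⟨B', hB', hBB', haB', hB'A⟩ := hA.exists_ge hB hBA {a k} (by simpa using ha k)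
    obtain ⟨u, hu, hu', huB, huW, huy⟩ := exists_unit_conj_notMem hA hA' hZ hB hBA hB' hB'A
      (mul_mem (mul_mem hg' hyA) hg) hyB
      ((Finset.range (k + 1)).image δ ∪
        (Finset.range (k + 1)).image fun i => (↑g⁻¹ : Module.End F V) (δ i))
    have huW' : ∀ v, (u : Module.End F V) v = v →
        (↑u⁻¹ : Module.End F V) v = v := by
      intro v hv
      have : (↑u⁻¹ * (u : Module.End F V)) v = v := by rw [u.inv_mul]; rfl
      rwa [Module.End.mul_apply, hv] at this
    refine ⟨⟨⟨B', g * u⟩, hB', hB'A, ?_, ?_, ?_⟩, hBB', haB' (by simp), ?_, ?_, ?_⟩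
    · exact mul_mem hg hu
    · simp only [_root_.mul_inv_rev, Units.val_mul]
      exact mul_mem hu' hg'
    · simpa only [_root_.mul_inv_rev, Units.val_mul, mul_assoc] using huy
    · intro b hb
      have h1 : (u : Module.End F V) * b * ↑u⁻¹ = b := by
        rw [(huB b hb).eq, mul_assoc, u.mul_inv, mul_one]
      simp only [_root_.mul_inv_rev, Units.val_mul]
      calc (g : Module.End F V) * ↑u * b * (↑u⁻¹ * ↑g⁻¹)
          = ↑g * (↑u * b * ↑u⁻¹) * ↑g⁻¹ := by simp only [mul_assoc]
        _ = _ := by rw [h1]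
    · intro i hi
      simp only [Units.val_mul, Module.End.mul_apply]
      rw [huW]
      exact Finset.mem_union_left _ (Finset.mem_image.2 ⟨i, by simpa [Nat.lt_succ_iff] using hi, rfl⟩)
    · intro i hi
      simp only [_root_.mul_inv_rev, Units.val_mul, Module.End.mul_apply]
      refine huW' _ (huW _ ?_)
      exact Finset.mem_union_right _ (Finset.mem_image.2 ⟨i, by simpa [Nat.lt_succ_iff] using hi, rfl⟩)
  choose next h1 h2 h3 h4 h5 using step
  have hbotmat : IsMatrixSubalgebra (⊥ : Subalgebra F (Module.End F V)) := by
    refine ⟨1, one_pos, (Algebra.ofId F _).comp (AlgHom.ofLinearMap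
      (entryLinearMap F F (0 : Fin 1) (0 : Fin 1)) (by simp) (by simp [Matrix.mul_apply])), ?_⟩
    refine le_bot_iff.1 ?_
    rintro _ ⟨M, rfl⟩
    exact Algebra.mem_bot.2 ⟨_, rfl⟩
  let p₀ : {p // good p} := ⟨⟨⊥, 1⟩, hbotmat, bot_le, one_mem _, by simp [one_mem], by simpa using hy⟩
  let p : ℕ → {p // good p} := fun k => Nat.rec p₀ next k
  let B : ℕ → Subalgebra F (Module.End F V) := fun k => (p k).1.1
  let g : ℕ → (Module.End F V)ˣ := fun k => (p k).1.2
  have hBmono : Monotone B := monotone_nat_of_le_succ fun k => h1 k (p k)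
  have hgB : ∀ k, ∀ b ∈ B k, ∀ j ≥ k, (g j : Module.End F V) * b * ↑(g j)⁻¹ =
      ↑(g k) * b * ↑(g k)⁻¹ := by
    intro k b hb j hj
    induction j, hj using Nat.le_induction with
    | base => rfl
    | succ j hj ih => rw [← ih]; exact h3 j (p j) b (hBmono hj hb)
  have hAB : ∀ x ∈ A, ∃ k, x ∈ B k := by
    intro x hx
    have hx' : x ∈ ⨆ k, B k :=
      hgen (⨆ k, B k) (fun k => (le_iSup B (k + 1)) (h2 k (p k))) hx
    rw [← SetLike.mem_coe, Subalgebra.coe_iSup_of_directed hBmono.directed_le] at hx'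
    simpa using hx'
  obtain ⟨G, hG⟩ := exists_pointwise_limit δ (fun k => (g k : Module.End F V))
    fun k i hi => h4 k (p k) i hi
  obtain ⟨H, hH⟩ := exists_pointwise_limit δ (fun k => (↑(g k)⁻¹ : Module.End F V))
    fun k i hi => h5 k (p k) i hi
  -- Products of pointwise limits are pointwise limits of products.
  have hGxH : ∀ x v, ∃ K, ∀ k ≥ K,
      ((g k : Module.End F V) * x * ↑(g k)⁻¹) v = (G * x * H) v := by
    intro x v
    obtain ⟨K, hK⟩ := hH v
    obtain ⟨K', hK'⟩ := hG (x (H v))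
    refine ⟨max K K', fun k hk => ?_⟩
    simp only [Module.End.mul_apply]
    rw [hK k (le_of_max_le_left hk), hK' k (le_of_max_le_right hk)]
  have hGH : G * H = 1 := by
    refine LinearMap.ext fun v => ?_
    obtain ⟨K, hK⟩ := hGxH 1 v
    have := hK K le_rfl
    rw [mul_one, mul_one, Units.mul_inv] at this
    exact this.symm
  have hHG : H * G = 1 := by
    refine LinearMap.ext fun v => ?_
    obtain ⟨K, hK⟩ := hG v
    obtain ⟨K', hK'⟩ := hH (G v)
    have h6 := hK _ (le_max_left K K')
    have h7 := hK' _ (le_max_right K K')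
    have h8 : (↑(g (max K K'))⁻¹ * (g (max K K') : Module.End F V)) v
        = v := by rw [Units.inv_mul]; rfl
    rw [Module.End.mul_apply, h6, h7] at h8
    exact h8
  have hGB : ∀ k, ∀ b ∈ B k, G * b * H = ↑(g k) * b * ↑(g k)⁻¹ := by
    intro k b hb
    refine LinearMap.ext fun v => ?_
    obtain ⟨K, hK⟩ := hGxH b v
    rw [← hK _ (le_max_left K k), hgB k b hb _ (le_max_right K k)]
  let e : V ≃ₗ[F] V := LinearEquiv.ofLinearMap H G hHG hGH
  have hmem : ∀ x, x ∈ A.map (e.conjAlgEquiv F : Module.End F V →ₐ[F] _) ↔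
      ∃ z ∈ A, H * z * G = x := fun x => Iff.rfl
  refine ⟨e, lt_of_le_of_ne (fun x hx => ?_) fun heq => ?_⟩
  · obtain ⟨k, hk⟩ := hAB x hx
    refine (hmem x).2 ⟨G * x * H, ?_, ?_⟩
    · rw [hGB k x hk]
      exact mul_mem (mul_mem (p k).2.2.2.1 hx) (p k).2.2.2.2.1
    · rw [show H * (G * x * H) * G = (H * G) * x * (H * G) by simp only [mul_assoc], hHG, one_mul,
        mul_one]
  · have hyA' : H * y * G ∈ A := by
      rw [heq]
      exact (hmem _).2 ⟨y, hyA, rfl⟩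
    obtain ⟨k, hk⟩ := hAB _ hyA'
    have h9 := hGB k _ hk
    rw [show G * (H * y * G) * H = (G * H) * y * (G * H) by simp only [mul_assoc], hGH, one_mul,
        mul_one] at h9
    apply (p k).2.2.2.2.2
    have h10 : (↑(g k)⁻¹ : Module.End F V) * y * ↑(g k) = H * y * G := by
      nth_rewrite 1 [h9]
      rw [mul_assoc, Units.inv_mul_cancel_right, Units.inv_mul_cancel_left]
    change (↑(g k)⁻¹ : Module.End F V) * y * ↑(g k) ∈ B k
    rw [h10]
    exact hk

end Enlarging

/-! ### Divisors of a Steinitz number -/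

namespace SteinitzNumber

lemma ofNat_mono {m n : ℕ} (hn : n ≠ 0) (h : m ∣ n) : ofNat m ≤ ofNat n := fun p => by
  have hm : m ≠ 0 := fun h0 => hn (by simpa [h0] using h)
  exact Nat.cast_le.2 ((Nat.factorization_le_iff_dvd hm hn).2 h p)

lemma ofNat_lcm_le {m n : ℕ} (hm : m ≠ 0) (hn : n ≠ 0) {s : SteinitzNumber} (hms : ofNat m ≤ s)
    (hns : ofNat n ≤ s) : ofNat (m.lcm n) ≤ s := fun p => by
  have h1 := hms p
  have h2 := hns p
  simp only [ofNat, Nat.factorization_lcm hm hn, Finsupp.sup_apply] at *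
  rcases max_choice (m.factorization p) (n.factorization p) with h | h
  · rwa [h]
  · rwa [h]

lemma ofNat_pow_le {s : SteinitzNumber} (p : Nat.Primes) (k : ℕ) (hk : (k : ℕ∞) ≤ s p) :
    ofNat ((p : ℕ) ^ k) ≤ s := fun q => by
  simp only [ofNat, p.2.factorization_pow]
  by_cases h : p = q
  · subst h; simpa using hk
  · have : (p : ℕ) ≠ q := fun h' => h (Subtype.ext h')
    simp [this]

/-- The positive integers dividing a Steinitz number. -/
abbrev Divisors (s : SteinitzNumber) : Type := {n : ℕ+ // ofNat n ≤ s}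

instance (s : SteinitzNumber) : Nonempty (Divisors s) :=
  ⟨⟨1, fun p => by simp [ofNat]⟩⟩

lemma exists_common_multiple {s : SteinitzNumber} (m n : Divisors s) :
    ∃ k : Divisors s, (m.1 : ℕ) ∣ k.1 ∧ (n.1 : ℕ) ∣ k.1 :=
  ⟨⟨⟨Nat.lcm m.1 n.1, Nat.lcm_pos m.1.pos n.1.pos⟩,
    ofNat_lcm_le m.1.ne_zero n.1.ne_zero m.2 n.2⟩, Nat.dvd_lcm_left _ _, Nat.dvd_lcm_right _ _⟩

lemma IsInfinite.exists_lt {s : SteinitzNumber} (hs : s.IsInfinite) (N : ℕ) :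
    ∃ n : Divisors s, N < n.1 := by
  by_contra! h
  -- A divisor of maximal size is divisible by all others.
  obtain ⟨n, hn⟩ : ∃ n : Divisors s, ∀ m : Divisors s, (m.1 : ℕ) ≤ n.1 := by
    have hfin : (Set.range fun n : Divisors s => (n.1 : ℕ)).Finite :=
      (Set.finite_Iic N).subset (by rintro _ ⟨n, rfl⟩; exact h n)
    obtain ⟨_, ⟨n, rfl⟩, hmax⟩ := hfin.exists_maximal (Set.range_nonempty _)
    exact ⟨n, fun m => by
      rcases le_total (m.1 : ℕ) n.1 with h' | h'
      · exact h'
      · exact hmax ⟨m, rfl⟩ h'⟩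
  have hdvd : ∀ m : Divisors s, (m.1 : ℕ) ∣ n.1 := by
    intro m
    obtain ⟨k, hmk, hnk⟩ := exists_common_multiple m n
    have : (k.1 : ℕ) = n.1 := le_antisymm (hn k) (Nat.le_of_dvd k.1.pos hnk)
    rwa [this] at hmk
  refine hs n.1 n.1.pos (le_antisymm (fun p => ?_) n.2)
  by_contra hlt
  rw [not_le] at hlt
  have hk : (((n.1 : ℕ).factorization p + 1 : ℕ) : ℕ∞) ≤ s p := by
    rw [Nat.cast_add, Nat.cast_one]
    exact Order.add_one_le_of_lt hlt
  have := hdvd ⟨⟨(p : ℕ) ^ _, pow_pos p.2.pos _⟩, ofNat_pow_le p _ hk⟩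
  exact Nat.pow_succ_factorization_not_dvd n.1.ne_zero p.2 this

end SteinitzNumber

/-! ### Unital homomorphisms between matrix algebras -/

section Degrees

open Matrix

variable {F : Type u} [Field F]

/-- A unital homomorphism `M_d(F) → M_n(F)` makes `F ^ n` a sum of `d` isomorphic subspaces. -/
lemma dvd_of_matrix_algHom {d n : ℕ} (hd : 0 < d)
    (h : Matrix (Fin d) (Fin d) F →ₐ[F] Matrix (Fin n) (Fin n) F) : d ∣ n := by
  let f : Matrix (Fin d) (Fin d) F →ₐ[F] Module.End F (Fin n → F) :=
    (Matrix.toLinAlgEquiv' : Matrix (Fin n) (Fin n) F ≃ₐ[F] _).toAlgHom.comp h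
  let o : Fin d := ⟨0, hd⟩
  have hff : ∀ i j k l v, f (single i j 1) (f (single k l 1) v) =
      if j = k then f (single i l 1) v else 0 := by
    intro i j k l v
    rw [← Module.End.mul_apply]
    split_ifs with hjk
    · rw [hjk, unit_mul_unit_same]
    · rw [unit_mul_unit_of_ne f hjk, LinearMap.zero_apply]
  let P := LinearMap.range (f (single o o 1))
  have hmem : ∀ i v, f (single o i 1) v ∈ P := fun i v =>
    LinearMap.mem_range.2 ⟨f (single o i 1) v, by simp [hff]⟩
  have hP : ∀ w : P, f (single o o 1) w = w := by
    rintro ⟨_, v, rfl⟩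
    simp [hff]
  let e : (Fin n → F) ≃ₗ[F] (Fin d → P) := LinearEquiv.ofLinearMap
    (LinearMap.pi fun i => (f (single o i 1)).codRestrict P (hmem i))
    (∑ i, (f (single i o 1)) ∘ₗ P.subtype ∘ₗ LinearMap.proj i)
    (by
      refine LinearMap.ext fun w => funext fun i => Subtype.ext ?_
      simp [LinearMap.codRestrict_apply, hff, hP])
    (by
      refine LinearMap.ext fun v => ?_
      simp only [LinearMap.comp_apply, LinearMap.sum_apply, LinearMap.proj_apply,
        LinearMap.pi_apply, Submodule.subtype_apply, LinearMap.codRestrict_apply, hff, if_true]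
      rw [← LinearMap.sum_apply, sum_units_eq_one]
      rfl)
  have := e.finrank_eq
  rw [Module.finrank_fin_fun, Module.finrank_pi_fintype] at this
  simp only [Finset.sum_const, Finset.card_univ, Fintype.card_fin, smul_eq_mul] at this
  exact ⟨_, this⟩

lemma matrix_algHom_injective {U : Type w} [Ring U] [Algebra F U] [Nontrivial U] {n : ℕ}
    (hn : 0 < n) (f : Matrix (Fin n) (Fin n) F →ₐ[F] U) : Function.Injective f := by
  have : Nonempty (Fin n) := ⟨⟨0, hn⟩⟩
  exact RingHom.injective f.toRingHom

lemma IsMatrixSubalgebra.exists_algEquiv {U : Type w} [Ring U] [Algebra F U] [Nontrivial U]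
    {B : Subalgebra F U} (hB : IsMatrixSubalgebra B) :
    ∃ n : ℕ, 0 < n ∧ Nonempty (B ≃ₐ[F] Matrix (Fin n) (Fin n) F) := by
  obtain ⟨n, hn, f, rfl⟩ := hB
  exact ⟨n, hn, ⟨(AlgEquiv.ofInjective f (matrix_algHom_injective hn f)).symm⟩⟩

/-- A finite subset of the union of a directed family of subalgebras lies in one of them. -/
lemma exists_subset_of_directed {U : Type w} [Ring U] [Algebra F U] {ι : Type*} [Nonempty ι]
    {K : ι → Subalgebra F U} (hK : Directed (· ≤ ·) K) (S : Finset U)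
    (hS : (S : Set U) ⊆ (⨆ i, K i : Subalgebra F U)) : ∃ i, (S : Set U) ⊆ K i := by
  classical
  induction S using Finset.induction_on with
  | empty => exact ⟨Classical.arbitrary ι, by simp⟩
  | insert a S _ ih =>
    rw [Finset.coe_insert, Set.insert_subset_iff] at hS
    obtain ⟨i, hi⟩ := ih hS.2
    have ha := hS.1
    rw [Subalgebra.coe_iSup_of_directed hK, Set.mem_iUnion] at ha
    obtain ⟨j, hj⟩ := ha
    obtain ⟨k, hik, hjk⟩ := hK i j
    refine ⟨k, ?_⟩
    rw [Finset.coe_insert, Set.insert_subset_iff]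
    exact ⟨hjk hj, hi.trans hik⟩

lemma range_le_of_units_mem {U : Type w} [Ring U] [Algebra F U] {n : ℕ}
    (f : Matrix (Fin n) (Fin n) F →ₐ[F] U) {B : Subalgebra F U}
    (h : ∀ i j, f (single i j 1) ∈ B) : f.range ≤ B := by
  rintro _ ⟨M, rfl⟩
  change f M ∈ B
  rw [map_eq_sum_units]
  exact sum_mem fun i _ => sum_mem fun j _ => B.smul_mem (h i j) _

lemma exists_range_le_of_directed {U : Type w} [Ring U] [Algebra F U] {ι : Type*} [Nonempty ι]
    {K : ι → Subalgebra F U} (hK : Directed (· ≤ ·) K) {n : ℕ}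
    (f : Matrix (Fin n) (Fin n) F →ₐ[F] U) (hf : f.range ≤ ⨆ i, K i) : ∃ i, f.range ≤ K i := by
  classical
  obtain ⟨i, hi⟩ := exists_subset_of_directed hK
    (Finset.univ.image fun p : Fin n × Fin n => f (single p.1 p.2 1)) (by
      intro x hx
      simp only [Finset.coe_image, Set.mem_image] at hx
      obtain ⟨p, -, rfl⟩ := hx
      exact hf (f.mem_range_self _))
  exact ⟨i, range_le_of_units_mem f fun a b => hi (by simp)⟩

end Degrees

/-! ### Block diagonal operators -/

section BlockDiagonal

open Matrix SteinitzNumber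

variable {F : Type u} [Field F] {V : Type w} [AddCommGroup V] [Module F V]

/-- The action of `M_n(F)` on a space with basis `δ` indexed by `ℕ`, by block diagonal operators:
the basis is cut into consecutive blocks of length `n`, and a matrix acts in the same way on each
block. -/
noncomputable def blockHom (δ : Module.Basis ℕ F V) (n : ℕ) [NeZero n] :
    Matrix (Fin n) (Fin n) F →ₐ[F] Module.End F V :=
  AlgHom.ofLinearMap
    { toFun := fun M => δ.constr F fun x => ∑ i, M i (Fin.ofNat n x) • δ (n * (x / n) + i)
      map_add' := fun M N => δ.ext fun x => by
        simp [Module.Basis.constr_basis, add_smul, Finset.sum_add_distrib]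
      map_smul' := fun c M => δ.ext fun x => by
        simp [Module.Basis.constr_basis, mul_smul, Finset.smul_sum] }
    (δ.ext fun x => by
      simp [Module.Basis.constr_basis, Matrix.one_apply, Nat.div_add_mod])
    (fun M N => δ.ext fun x => by
      have h1 : ∀ j : Fin n, Fin.ofNat n (n * (x / n) + j) = j := fun j =>
        Fin.ext (by simp [Nat.mod_eq_of_lt])
      have h2 : ∀ j : Fin n, (n * (x / n) + j) / n = x / n := fun j => by
        rw [Nat.mul_add_div (Nat.pos_of_ne_zero (NeZero.ne n)), Nat.div_eq_of_lt j.2, add_zero]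
      simp only [LinearMap.coe_mk, AddHom.coe_mk, Module.End.mul_apply, Module.Basis.constr_basis,
        map_sum, map_smul, h1, h2, Matrix.mul_apply, Finset.sum_smul, Finset.smul_sum, smul_smul]
      rw [Finset.sum_comm]
      simp only [mul_comm])

variable (δ : Module.Basis ℕ F V)

lemma blockHom_apply_basis (n : ℕ) [NeZero n] (M : Matrix (Fin n) (Fin n) F) (x : ℕ) :
    blockHom δ n M (δ x) = ∑ i, M i (Fin.ofNat n x) • δ (n * (x / n) + i) := by
  simp [blockHom, Module.Basis.constr_basis]

lemma repr_blockHom (n : ℕ) [NeZero n] (M : Matrix (Fin n) (Fin n) F) (x y : ℕ) :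
    δ.repr (blockHom δ n M (δ x)) y =
      if y / n = x / n then M (Fin.ofNat n y) (Fin.ofNat n x) else 0 := by
  rw [blockHom_apply_basis]
  simp only [map_sum, map_smul, Module.Basis.repr_self, Finsupp.coe_finsetSum, Finset.sum_apply,
    Finsupp.smul_apply, Finsupp.single_apply, smul_eq_mul, mul_ite, mul_one, mul_zero]
  split_ifs with h
  · rw [Finset.sum_eq_single (Fin.ofNat n y)]
    · rw [if_pos]
      rw [← h, Fin.val_ofNat, Nat.div_add_mod]
    · intro i _ hi
      rw [if_neg]
      rintro rfl
      exact hi (Fin.ext (by simp [Nat.mod_eq_of_lt]))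
    · simp
  · refine Finset.sum_eq_zero fun i _ => if_neg ?_
    rintro rfl
    apply h
    rw [Nat.mul_add_div (Nat.pos_of_ne_zero (NeZero.ne n)), Nat.div_eq_of_lt i.2, add_zero]

lemma blockHom_single_apply (n : ℕ) [NeZero n] (i j : Fin n) (x : ℕ) :
    blockHom δ n (single i j 1) (δ x) =
      if Fin.ofNat n x = j then δ (n * (x / n) + i) else 0 := by
  rw [blockHom_apply_basis]
  split_ifs with h
  · rw [Finset.sum_eq_single i]
    · rw [h, single_apply_same, one_smul]
    · intro k _ hk; simp [single_apply_of_row_ne hk.symm]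
    · simp
  · exact Finset.sum_eq_zero fun k _ => by
      rw [single_apply_of_col_ne _ _ (Ne.symm h), zero_smul]

lemma range_blockHom_le {m n : ℕ} [NeZero m] [NeZero n] (h : m ∣ n) :
    (blockHom δ m).range ≤ (blockHom δ n).range := by
  rintro _ ⟨M, rfl⟩
  refine ⟨Matrix.of fun i j => if (i : ℕ) / m = j / m then M (Fin.ofNat m i) (Fin.ofNat m j) else 0,
    δ.ext fun x => δ.repr.injective (Finsupp.ext fun y => ?_)⟩
  change δ.repr (blockHom δ n _ (δ x)) y = δ.repr (blockHom δ m _ (δ x)) y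
  rw [repr_blockHom, repr_blockHom]
  obtain ⟨k, rfl⟩ := h
  have hm : 0 < m := Nat.pos_of_ne_zero (NeZero.ne m)
  have hk : 0 < k := Nat.pos_of_ne_zero fun h => NeZero.ne (m * k) (by simp [h])
  have h1 : ∀ z : ℕ, z % (m * k) / m = z / m % k := fun z => Nat.mod_mul_right_div_self z m k
  have h2 : ∀ z : ℕ, z / (m * k) = z / m / k := fun z => (Nat.div_div_eq_div_mul z m k).symm
  have h3 : ∀ z : ℕ, Fin.ofNat m (z % (m * k)) = Fin.ofNat m z := fun z =>
    Fin.ext (by simp)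
  simp only [Matrix.of_apply, Fin.val_ofNat, h1, h2, h3]
  by_cases hq : y / m = x / m
  · rw [if_pos hq, if_pos (by rw [hq]), if_pos (by rw [hq])]
  · rw [if_neg hq]
    split_ifs with h4 h5
    · exact absurd (by rw [← Nat.div_add_mod (y / m) k, h4, h5, Nat.div_add_mod]) hq
    · rfl
    · rfl

/-- The union of the algebras of block diagonal operators whose block length divides `s`. -/
noncomputable def blockAlgebra (s : SteinitzNumber) : Subalgebra F (Module.End F V) :=
  ⨆ n : Divisors s, (blockHom δ n.1).range

lemma directed_range_blockHom (s : SteinitzNumber) :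
    Directed (· ≤ ·) fun n : Divisors s => (blockHom δ n.1).range := fun m n => by
  obtain ⟨k, hmk, hnk⟩ := exists_common_multiple m n
  exact ⟨k, range_blockHom_le δ hmk, range_blockHom_le δ hnk⟩

lemma blockHom_mem_blockAlgebra {s : SteinitzNumber} (n : Divisors s)
    (M : Matrix (Fin n.1) (Fin n.1) F) : blockHom δ n.1 M ∈ blockAlgebra δ s :=
  le_iSup (fun n : Divisors s => (blockHom δ n.1).range) n ((blockHom δ n.1).mem_range_self M)

lemma isLocallyMatrix_blockAlgebra (s : SteinitzNumber) : IsLocallyMatrix (blockAlgebra δ s) := by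
  intro S hS
  obtain ⟨n, hn⟩ := exists_subset_of_directed (directed_range_blockHom δ s) S hS
  exact ⟨_, ⟨n.1, n.1.pos, _, rfl⟩, hn,
    le_iSup (fun n : Divisors s => (blockHom δ n.1).range) n⟩

lemma ofNat_le_of_range_le_blockAlgebra {s : SteinitzNumber} {d : ℕ} (hd : 0 < d)
    (f : Matrix (Fin d) (Fin d) F →ₐ[F] Module.End F V) (hf : f.range ≤ blockAlgebra δ s) :
    ofNat d ≤ s := by
  have hnt : Nontrivial V := ⟨δ 0, 0, δ.ne_zero 0⟩
  obtain ⟨n, hn⟩ := exists_range_le_of_directed (directed_range_blockHom δ s) f hf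
  let e := AlgEquiv.ofInjective (blockHom δ n.1) (matrix_algHom_injective n.1.pos _)
  have := dvd_of_matrix_algHom hd
    (e.symm.toAlgHom.comp (f.codRestrict _ fun M => hn (f.mem_range_self M)))
  exact (ofNat_mono n.1.ne_zero this).trans n.2

/-- A bound on the supports of finitely many vectors. -/
lemma exists_forall_repr_eq_zero (W : Finset V) : ∃ N, ∀ v ∈ W, ∀ x ≥ N, δ.repr v x = 0 := by
  classical
  refine ⟨(W.biUnion fun v => (δ.repr v).support).sup id + 1, fun v hv x hx => ?_⟩
  by_contra h
  have : x ≤ (W.biUnion fun v => (δ.repr v).support).sup id :=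
    Finset.le_sup (f := id) (Finset.mem_biUnion.2 ⟨v, hv, Finsupp.mem_support_iff.2 h⟩)
  omega

lemma eq_sum_repr_of_forall_eq_zero {v : V} {N : ℕ} (h : ∀ x ≥ N, δ.repr v x = 0) :
    v = ∑ x ∈ Finset.range N, δ.repr v x • δ x := by
  conv_lhs => rw [← δ.linearCombination_repr v, Finsupp.linearCombination_apply]
  refine Finsupp.sum_of_support_subset _ (fun x hx => ?_) _ (by simp)
  by_contra hx'
  exact Finsupp.mem_support_iff.1 hx (h x (by simpa using hx'))

lemma hasAnnihilators_blockAlgebra {s : SteinitzNumber} (hs : s.IsInfinite) :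
    HasAnnihilators (blockAlgebra δ s) := by
  intro W
  obtain ⟨N, hN⟩ := exists_forall_repr_eq_zero δ W
  obtain ⟨n, hn⟩ := hs.exists_lt N
  let j : Fin n.1 := ⟨N, hn⟩
  refine ⟨_, blockHom_mem_blockAlgebra δ n (single j j 1), fun h => ?_, fun v hv => ?_⟩
  · have := congrArg (fun T => T (δ N)) h
    simp only [blockHom_single_apply, LinearMap.zero_apply] at this
    rw [if_pos (Fin.ext (by simp [j, Nat.mod_eq_of_lt hn]))] at this
    exact δ.ne_zero _ this
  · rw [eq_sum_repr_of_forall_eq_zero δ (hN v hv), map_sum]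
    refine Finset.sum_eq_zero fun x hx => ?_
    have hx' : x < N := by simpa using hx
    rw [map_smul, blockHom_single_apply, if_neg, smul_zero]
    intro h
    have := congrArg Fin.val h
    simp only [Fin.val_ofNat, j, Nat.mod_eq_of_lt (hx'.trans hn)] at this
    omega

/-- Only scalars commute with the block algebra: since the block lengths are unbounded, `T (δ 0)` is
fixed by the projection onto the first vectors of all blocks of some length exceeding its support,
so it is a multiple of `δ 0`, and the matrix units carry `δ 0` to every basis vector. -/
lemma mem_bot_of_commute_blockAlgebra {s : SteinitzNumber} (hs : s.IsInfinite)
    {T : Module.End F V} (hT : ∀ a ∈ blockAlgebra δ s, Commute T a) :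
    T ∈ (⊥ : Subalgebra F (Module.End F V)) := by
  have key : ∀ (n : Divisors s) (i j : Fin n.1) v,
      T (blockHom δ n.1 (single i j 1) v) = blockHom δ n.1 (single i j 1) (T v) :=
    fun n i j v => congrArg (fun S => S v) (hT _ (blockHom_mem_blockAlgebra δ n (single i j 1))).eq
  have h0 : T (δ 0) = δ.repr (T (δ 0)) 0 • δ 0 := by
    obtain ⟨N, hN⟩ := exists_forall_repr_eq_zero δ {T (δ 0)}
    obtain ⟨n, hn⟩ := hs.exists_lt N
    have h := key n 0 0 (δ 0)
    simp only [blockHom_single_apply, Nat.zero_div, mul_zero, zero_add] at h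
    rw [if_pos (by simp), Fin.val_zero] at h
    have hv := eq_sum_repr_of_forall_eq_zero δ (hN (T (δ 0)) (by simp))
    replace h := h.trans (congrArg (blockHom δ n.1 (single 0 0 1)) hv)
    rw [map_sum] at h
    rw [Finset.sum_eq_single 0] at h
    · rw [map_smul, blockHom_single_apply] at h
      simpa using h
    · intro x hx hx0
      have hx' : x < N := by simpa using hx
      rw [map_smul, blockHom_single_apply, if_neg, smul_zero]
      intro h
      have := congrArg Fin.val h
      simp only [Fin.val_ofNat, Fin.val_zero, Nat.mod_eq_of_lt (hx'.trans hn)] at this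
      omega
    · intro h0
      have : N = 0 := by simpa using h0
      rw [hN _ (by simp) 0 (by omega), zero_smul, map_zero]
  refine Algebra.mem_bot.2 ⟨δ.repr (T (δ 0)) 0, δ.ext fun x => ?_⟩
  rw [Module.algebraMap_end_apply]
  obtain ⟨n, hn⟩ := hs.exists_lt x
  have h := key n ⟨x, hn⟩ 0 (δ 0)
  rw [h0, map_smul] at h
  simp only [blockHom_single_apply, Nat.zero_div, mul_zero, zero_add] at h
  rw [if_pos (by simp)] at h
  exact h.symm

end BlockDiagonal

/-! ### Locally matrix extensions with a prescribed Steinitz number -/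

section Extensions

open Matrix SteinitzNumber

variable {F : Type u} [Field F] {U : Type w} [Ring U] [Algebra F U]

/-- `A` is a locally matrix algebra that contains `A₀`, and the degrees of its matrix subalgebras
all divide `s`. -/
structure IsSteinitzExtension (A₀ : Subalgebra F U) (s : SteinitzNumber) (A : Subalgebra F U) :
    Prop where
  le : A₀ ≤ A
  isLocallyMatrix : IsLocallyMatrix A
  ofNat_le : ∀ d : ℕ, 0 < d → ∀ f : Matrix (Fin d) (Fin d) F →ₐ[F] U, f.range ≤ A → ofNat d ≤ s

lemma IsMatrixSubalgebra.map {U' : Type*} [Ring U'] [Algebra F U'] {B : Subalgebra F U}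
    (hB : IsMatrixSubalgebra B) (σ : U →ₐ[F] U') : IsMatrixSubalgebra (B.map σ) := by
  obtain ⟨n, hn, f, rfl⟩ := hB
  exact ⟨n, hn, σ.comp f, AlgHom.range_comp f σ⟩

lemma IsLocallyMatrix.map {A : Subalgebra F U} (hA : IsLocallyMatrix A) (σ : U ≃ₐ[F] U) :
    IsLocallyMatrix (A.map (σ : U →ₐ[F] U)) := by
  classical
  intro S hS
  obtain ⟨B, hB, hSB, hBA⟩ := hA (S.image σ.symm) (by
    intro x hx
    simp only [Finset.coe_image, Set.mem_image] at hx
    obtain ⟨y, hy, rfl⟩ := hx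
    obtain ⟨z, hz, rfl⟩ := hS hy
    simpa using hz)
  refine ⟨B.map (σ : U →ₐ[F] U), hB.map _, fun y hy => ⟨σ.symm y, hSB ?_, by simp⟩,
    Subalgebra.map_mono hBA⟩
  exact Finset.mem_coe.2 (Finset.mem_image_of_mem _ hy)

lemma IsSteinitzExtension.map {A₀ A : Subalgebra F U} {s : SteinitzNumber}
    (hA : IsSteinitzExtension A₀ s A) (σ : U ≃ₐ[F] U) (hσ : A ≤ A.map (σ : U →ₐ[F] U)) :
    IsSteinitzExtension A₀ s (A.map (σ : U →ₐ[F] U)) where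
  le := hA.le.trans hσ
  isLocallyMatrix := hA.isLocallyMatrix.map σ
  ofNat_le d hd f hf := by
    refine hA.ofNat_le d hd ((σ.symm : U →ₐ[F] U).comp f) ?_
    rintro _ ⟨M, rfl⟩
    obtain ⟨z, hz, hz'⟩ := hf (f.mem_range_self M)
    change σ.symm (f M) ∈ A
    rw [← hz']
    simpa using hz

lemma exists_maximal_isSteinitzExtension {A₀ : Subalgebra F U} {s : SteinitzNumber}
    (hA₀ : IsSteinitzExtension A₀ s A₀) : ∃ A, Maximal (IsSteinitzExtension A₀ s) A := by
  obtain ⟨A, -, hA⟩ := zorn_le_nonempty₀ {A | IsSteinitzExtension A₀ s A} (fun c hc hchain B hB => by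
    have : Nonempty c := ⟨⟨B, hB⟩⟩
    have hdir : Directed (· ≤ ·) fun C : c => (C : Subalgebra F U) :=
      hchain.directedOn.directed_val
    have hle : ∀ C : c, (C : Subalgebra F U) ≤ ⨆ C : c, (C : Subalgebra F U) :=
      le_iSup fun C : c => (C : Subalgebra F U)
    refine ⟨⨆ C : c, (C : Subalgebra F U), ⟨(hc hB).le.trans (hle ⟨B, hB⟩), fun S hS => ?_,
      fun d hd f hf => ?_⟩, fun C hC => hle ⟨C, hC⟩⟩
    · obtain ⟨C, hC⟩ := exists_subset_of_directed hdir S hS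
      obtain ⟨B', hB', hS', hB'C⟩ := (hc C.2).isLocallyMatrix S hC
      exact ⟨B', hB', hS', hB'C.trans (hle C)⟩
    · obtain ⟨C, hC⟩ := exists_range_le_of_directed hdir f hf
      exact (hc C.2).ofNat_le d hd f hC) A₀ hA₀
  exact ⟨A, hA⟩

lemma IsLocallyMatrix.isLocallyMatrixAlgebra [Nontrivial U] {A : Subalgebra F U}
    (hA : IsLocallyMatrix A) : IsLocallyMatrixAlgebra F A := by
  classical
  intro S
  obtain ⟨_, ⟨n, hn, f, rfl⟩, hS, hBA⟩ := hA (S.image A.val) (by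
    intro x hx
    simp only [Finset.coe_image, Set.mem_image] at hx
    obtain ⟨y, -, rfl⟩ := hx
    exact y.2)
  refine ⟨(f.codRestrict A fun M => hBA (f.mem_range_self M)).range, fun a ha => ?_,
    IsMatrixSubalgebra.exists_algEquiv ⟨n, hn, _, rfl⟩⟩
  obtain ⟨M, hM⟩ := hS (Finset.mem_coe.2 (Finset.mem_image_of_mem A.val ha))
  exact ⟨M, Subtype.ext hM⟩

end Extensions

section BlockExtensions

open Matrix SteinitzNumber

variable {F : Type u} [Field F] {V : Type w} [AddCommGroup V] [Module F V]
  (δ : Module.Basis ℕ F V) {s : SteinitzNumber}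

lemma isSteinitzExtension_blockAlgebra :
    IsSteinitzExtension (blockAlgebra δ s) s (blockAlgebra δ s) where
  le := le_rfl
  isLocallyMatrix := isLocallyMatrix_blockAlgebra δ s
  ofNat_le _ hd f hf := ofNat_le_of_range_le_blockAlgebra δ hd f hf

lemma IsSteinitzExtension.steinitzNumberOf_eq {A : Subalgebra F (Module.End F V)}
    (hA : IsSteinitzExtension (blockAlgebra δ s) s A) : steinitzNumberOf F A = s := by
  have hnt : Nontrivial V := ⟨δ 0, 0, δ.ne_zero 0⟩
  refine le_antisymm (sSup_le ?_) fun p => ENat.forall_natCast_le_iff_le.1 fun k hk => ?_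
  · rintro _ ⟨n, ⟨hn, B, ⟨e⟩⟩, rfl⟩
    refine hA.ofNat_le n hn (A.val.comp (B.val.comp (e.symm : _ →ₐ[F] B))) ?_
    rintro _ ⟨M, rfl⟩
    exact ((e.symm M : B) : A).2
  · let n : Divisors s := ⟨⟨(p : ℕ) ^ k, pow_pos p.2.pos _⟩, ofNat_pow_le p k hk⟩
    have hn : ((p : ℕ) ^ k) ∈ matrixDegrees F A := by
      let f := (blockHom δ n.1).codRestrict A fun M => hA.le (blockHom_mem_blockAlgebra δ n M)
      exact ⟨pow_pos p.2.pos _, f.range,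
        ⟨(AlgEquiv.ofInjective f (matrix_algHom_injective n.1.pos f)).symm⟩⟩
    have h1 : ofNat ((p : ℕ) ^ k) ≤ steinitzNumberOf F A := le_sSup ⟨_, hn, rfl⟩
    have h2 := h1 p
    simpa [ofNat, p.2.factorization_pow] using h2

/-- A maximal locally matrix extension of the block algebra with the same Steinitz number is not
countably generated, since a countably generated one is a proper subalgebra of one of its
conjugates. -/
lemma not_countably_generated_of_maximal (hs : s.IsInfinite) {A : Subalgebra F (Module.End F V)}
    (hA : Maximal (IsSteinitzExtension (blockAlgebra δ s) s) A) (a : ℕ → Module.End F V)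
    (ha : ∀ k, a k ∈ A) : ∃ C : Subalgebra F (Module.End F V), (∀ k, a k ∈ C) ∧ ¬ A ≤ C := by
  by_contra! hgen
  have hann : HasAnnihilators A := fun W => by
    obtain ⟨b, hb, h⟩ := hasAnnihilators_blockAlgebra δ hs W
    exact ⟨b, hA.prop.le hb, h⟩
  have hbot : A ≠ ⊥ := by
    rintro rfl
    obtain ⟨b, hb, hb0, hbδ⟩ := hann {δ 0}
    obtain ⟨c, rfl⟩ := Algebra.mem_bot.1 hb
    have h := hbδ (δ 0) (by simp)
    rw [Module.algebraMap_end_apply] at h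
    have hc : c = 0 := (smul_eq_zero.1 h).resolve_right (δ.ne_zero 0)
    exact hb0 (by rw [hc, map_zero])
  obtain ⟨e, he⟩ := exists_conj_gt δ hA.prop.isLocallyMatrix hann
    (fun z _ h => mem_bot_of_commute_blockAlgebra δ hs fun b hb => h b (hA.prop.le hb))
    hbot a ha hgen
  exact he.not_ge (hA.le_of_ge (hA.prop.map _ he.le) he.le)

end BlockExtensions

/-! ### Infinite tensor products of matrix algebras -/

section TensorProducts

universe w'

open scoped TensorProduct
open Matrix

variable {F : Type u} [Field F] {ι : Type v}

/-- The infinite product of linear functionals with `ℓ i 1 = 1`, extended by zero to the families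
that differ from `1` at infinitely many places; changing one entry does not affect that
condition. -/
noncomputable def finiteProductForm {B : ι → Type w} [∀ i, Ring (B i)] [∀ i, Algebra F (B i)]
    (ℓ : ∀ i, B i →ₗ[F] F) (hℓ : ∀ i, ℓ i 1 = 1) : MultilinearMap F B F := by
  classical
  let m : (∀ i, B i) → F := fun b => if {i | b i ≠ 1}.Finite then ∏ᶠ i, ℓ i (b i) else 0
  have key : ∀ [DecidableEq ι] (b : ∀ i, B i) (i : ι) (x : B i),
      m (Function.update b i x) = ℓ i x * m (Function.update b i 1) := by
    intro _ b i x
    have hsub : ∀ y : B i, {j | Function.update b i y j ≠ 1} ⊆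
        insert i {j | Function.update b i 1 j ≠ 1} := by
      intro y j hj
      by_cases hji : j = i
      · exact Or.inl hji
      · exact Or.inr (by simpa [hji] using hj)
    have hsub' : {j | Function.update b i 1 j ≠ 1} ⊆ {j | Function.update b i x j ≠ 1} := by
      intro j hj
      by_cases hji : j = i
      · subst hji; simp at hj
      · simpa [hji] using hj
    by_cases hfin : {j | Function.update b i 1 j ≠ 1}.Finite
    · have hsupp : ∀ y : B i, Function.mulSupport (fun j => ℓ j (Function.update b i y j)) ⊆
          ((insert i hfin.toFinset : Finset ι) : Set ι) := by
        intro y j hj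
        have : j ∈ {j | Function.update b i y j ≠ 1} := by
          intro h
          apply hj
          simp only [h, hℓ]
        simpa using hsub y this
      have hval : ∀ y : B i, m (Function.update b i y) =
          ℓ i y * ∏ j ∈ (insert i hfin.toFinset).erase i, ℓ j (b j) := by
        intro y
        simp only [m]
        rw [if_pos ((hfin.insert i).subset (hsub y)),
          finprod_eq_prod_of_mulSupport_subset _ (hsupp y),
          ← Finset.mul_prod_erase _ _ (Finset.mem_insert_self i _), Function.update_self]
        congr 1
        refine Finset.prod_congr rfl fun j hj => ?_
        rw [Function.update_of_ne (Finset.ne_of_mem_erase hj)]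
      rw [hval, hval, hℓ, one_mul]
    · simp only [m]
      rw [if_neg hfin, if_neg fun h => hfin (h.subset hsub'), mul_zero]
  exact
    { toFun := m
      map_update_add' := fun b i x y => by rw [key, key b i x, key b i y, map_add, add_mul]
      map_update_smul' := fun b i c x => by
        rw [key, key b i x, map_smul, smul_eq_mul, smul_eq_mul, mul_assoc] }

lemma finiteProductForm_one {B : ι → Type w} [∀ i, Ring (B i)] [∀ i, Algebra F (B i)]
    (ℓ : ∀ i, B i →ₗ[F] F) (hℓ : ∀ i, ℓ i 1 = 1) : finiteProductForm ℓ hℓ 1 = 1 := by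
  classical
  change (if {i | (1 : ∀ i, B i) i ≠ 1}.Finite then ∏ᶠ i, ℓ i ((1 : ∀ i, B i) i) else 0) = 1
  simp [hℓ]

lemma nontrivial_piTensorProduct_matrix (n : ι → ℕ) (hn : ∀ i, 0 < n i) :
    Nontrivial (⨂[F] i, Matrix (Fin (n i)) (Fin (n i)) F) := by
  let Φ := PiTensorProduct.lift (finiteProductForm (F := F)
    (fun i => entryLinearMap F F (⟨0, hn i⟩ : Fin (n i)) (⟨0, hn i⟩ : Fin (n i)))
    (fun i => by simp))
  refine ⟨1, 0, fun h => ?_⟩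
  have h1 := congrArg Φ h
  rw [map_zero, PiTensorProduct.one_def, PiTensorProduct.lift.tprod, finiteProductForm_one] at h1
  exact one_ne_zero h1

lemma commute_singleAlgHom [DecidableEq ι] {B : ι → Type w} [∀ i, Ring (B i)]
    [∀ i, Algebra F (B i)] {i j : ι} (h : i ≠ j) (a : B i) (b : B j) :
    Commute (PiTensorProduct.singleAlgHom (R := F) (A := B) i a)
      (PiTensorProduct.singleAlgHom (R := F) (A := B) j b) :=
  Commute.tprod (Pi.mulSingle_commute h a b)

lemma exists_finset_mem_iSup {U : Type w} [Ring U] [Algebra F U] (R : ι → Subalgebra F U) {x : U}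
    (hx : x ∈ ⨆ i, R i) : ∃ t : Finset ι, x ∈ ⨆ i ∈ t, R i := by
  classical
  rw [iSup_eq_iSup_finset, ← SetLike.mem_coe, Subalgebra.coe_iSup_of_directed] at hx
  · simpa using hx
  · intro t t'
    exact ⟨t ∪ t', biSup_mono fun i hi => Finset.mem_union_left _ hi,
      biSup_mono fun i hi => Finset.mem_union_right _ hi⟩

open SteinitzNumber

variable {V : Type w} [AddCommGroup V] [Module F V] (δ : Module.Basis ℕ F V) {s : SteinitzNumber}

/-- A maximal extension `A` of the block algebra is not generated by commuting matrix subalgebras.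
The block algebra is countably generated, so it lies in the subalgebra generated by countably many
of the matrix subalgebras.  Every further one centralizes it and is therefore one-dimensional, so
that `A` would be countably generated. -/
lemma isEmpty_algEquiv_iSup_range_of_maximal (hs : s.IsInfinite)
    {A : Subalgebra F (Module.End F V)}
    (hA : Maximal (IsSteinitzExtension (blockAlgebra δ s) s) A)
    {P : Type w'} [Ring P] [Algebra F P] [Nontrivial P] (n : ι → ℕ) (hn : ∀ i, 0 < n i)
    (σ : ∀ i, Matrix (Fin (n i)) (Fin (n i)) F →ₐ[F] P)
    (hσ : ∀ i j, i ≠ j → ∀ x y, Commute (σ i x) (σ j y))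
    (T : Subalgebra F P) (hT : T = ⨆ i, (σ i).range) : IsEmpty (A ≃ₐ[F] T) := by
  classical
  refine ⟨fun φ => ?_⟩
  have hnt : Nontrivial V := ⟨δ 0, 0, δ.ne_zero 0⟩
  have hσT : ∀ i x, σ i x ∈ T := fun i x =>
    hT ▸ le_iSup (fun i => (σ i).range) i ((σ i).mem_range_self x)
  have hfin : ∀ x : A, ∃ t : Finset ι, (φ x : P) ∈ ⨆ i ∈ t, (σ i).range := fun x =>
    exists_finset_mem_iSup _ (hT ▸ (φ x).2)
  choose t ht using hfin
  let unit : (Σ d : Divisors s, Fin d.1 × Fin d.1) → A := fun q =>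
    ⟨blockHom δ q.1.1 (single q.2.1 q.2.2 1), hA.prop.le (blockHom_mem_blockAlgebra δ q.1 _)⟩
  let J : Set ι := ⋃ q, (t (unit q) : Set ι)
  have hJ : J.Countable := Set.countable_iUnion fun q => Finset.countable_toSet _
  have hbase : ∀ x : A, (x : Module.End F V) ∈ blockAlgebra δ s →
      (φ x : P) ∈ ⨆ i ∈ J, (σ i).range := by
    intro x hx
    let C := ((⨆ i ∈ J, (σ i).range).comap (T.val.comp (φ : A →ₐ[F] T))).map A.val
    have hC : blockAlgebra δ s ≤ C := iSup_le fun d => range_le_of_units_mem _ fun i j =>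
      ⟨unit ⟨d, i, j⟩, (biSup_mono (f := fun i => (σ i).range) fun k hk =>
        Set.mem_iUnion.2 ⟨⟨d, i, j⟩, hk⟩ : _ ≤ ⨆ i ∈ J, (σ i).range) (ht _), rfl⟩
    obtain ⟨y, hy, hyx⟩ := hC hx
    have : y = x := Subtype.ext hyx
    exact this ▸ hy
  have hone : ∀ j ∉ J, n j = 1 := by
    intro j hj
    by_contra hj1
    have hj2 : 1 < n j := lt_of_le_of_ne (hn j) (Ne.symm hj1)
    let E : Matrix (Fin (n j)) (Fin (n j)) F := single ⟨0, hn j⟩ ⟨1, hj2⟩ 1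
    have hE0 : E ≠ 0 := fun h => by
      have := congrFun (congrFun h ⟨0, hn j⟩) ⟨1, hj2⟩
      simp [E] at this
    have hEE : E * E = 0 := single_mul_single_of_ne _ _ _ _ (by simp) _
    let z : A := φ.symm ⟨σ j E, hσT j E⟩
    have hφz : (φ z : P) = σ j E := by simp [z]
    have hz0 : z ≠ 0 := fun h => by
      rw [h, map_zero] at hφz
      exact hE0 (matrix_algHom_injective (hn j) (σ j) (by rw [map_zero]; exact hφz.symm))
    have hzz : z * z = 0 := φ.injective (Subtype.ext (by
      rw [map_mul, map_zero, Subalgebra.coe_mul, hφz, ← map_mul, hEE, map_zero]; rfl))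
    have hcent : ⨆ i ∈ J, (σ i).range ≤ Subalgebra.centralizer F {σ j E} := by
      refine iSup₂_le fun i hi => ?_
      rintro _ ⟨x, rfl⟩
      rw [Subalgebra.mem_centralizer_iff]
      rintro _ rfl
      exact hσ j i (fun h => hj (by rwa [h])) E x
    have hzc : (z : Module.End F V) ∈ (⊥ : Subalgebra F (Module.End F V)) := by
      refine mem_bot_of_commute_blockAlgebra δ hs fun b hb => ?_
      have hb' := hcent (hbase ⟨b, hA.prop.le hb⟩ hb)
      rw [Subalgebra.mem_centralizer_iff] at hb'
      have h2 := hb' _ rfl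
      rw [← hφz] at h2
      have h3 : z * ⟨b, hA.prop.le hb⟩ = ⟨b, hA.prop.le hb⟩ * z :=
        φ.injective (Subtype.ext (by simpa using h2))
      exact congrArg Subtype.val h3
    obtain ⟨c, hc⟩ := Algebra.mem_bot.1 hzc
    have hcc : algebraMap F (Module.End F V) (c * c) = 0 := by
      rw [map_mul, hc]; exact congrArg Subtype.val hzz
    have hc0 : c = 0 := mul_self_eq_zero.1
      ((algebraMap F (Module.End F V)).injective (hcc.trans (map_zero _).symm))
    exact hz0 (Subtype.ext (by rw [← hc, hc0, map_zero]; rfl))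
  have : Countable J := hJ
  let gen : Option (Σ j : J, Fin (n j) × Fin (n j)) → A := fun q =>
    q.elim 0 fun q => φ.symm ⟨σ q.1 (single q.2.1 q.2.2 1), hσT _ _⟩
  obtain ⟨enum, henum⟩ := exists_surjective_nat (Option (Σ j : J, Fin (n j) × Fin (n j)))
  obtain ⟨C, hC, hAC⟩ := not_countably_generated_of_maximal δ hs hA
    (fun k => gen (enum k)) fun k => (gen (enum k)).2
  apply hAC
  have hgen : ∀ q, (gen q : Module.End F V) ∈ C := fun q => by
    obtain ⟨k, rfl⟩ := henum q
    exact hC k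
  let D := ((C.comap A.val).map (φ : A →ₐ[F] T)).map T.val
  have hTD : T ≤ D := by
    rw [hT]
    refine iSup_le fun j => range_le_of_units_mem _ fun a b => ?_
    by_cases hj : j ∈ J
    · exact ⟨⟨_, hσT j _⟩, ⟨gen (some ⟨⟨j, hj⟩, a, b⟩), hgen _, by simp [gen]⟩, rfl⟩
    · have hsub : Subsingleton (Fin (n j)) := by rw [hone j hj]; infer_instance
      have h1 : single a b (1 : F) = 1 := by
        ext k l
        rw [Subsingleton.elim k a, Subsingleton.elim l a, Subsingleton.elim b a]
        simp
      rw [h1, map_one]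
      exact one_mem D
  intro x hx
  obtain ⟨_, ⟨y, hy, rfl⟩, hyx⟩ := hTD (φ ⟨x, hx⟩).2
  have : y = ⟨x, hx⟩ := φ.injective (Subtype.ext hyx)
  subst this
  exact hy

lemma isEmpty_algEquiv_algebraTensorProduct_of_maximal (hs : s.IsInfinite)
    {A : Subalgebra F (Module.End F V)}
    (hA : Maximal (IsSteinitzExtension (blockAlgebra δ s) s) A) (n : ι → ℕ) (hn : ∀ i, 0 < n i) :
    IsEmpty (A ≃ₐ[F] algebraTensorProduct F fun i => Matrix (Fin (n i)) (Fin (n i)) F) := by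
  classical
  have := nontrivial_piTensorProduct_matrix (F := F) n hn
  let B : ι → Type u := fun i => Matrix (Fin (n i)) (Fin (n i)) F
  have hcomm : ∀ i j, i ≠ j → ∀ (x : B i) (y : B j),
      Commute (PiTensorProduct.singleAlgHom (R := F) (A := B) i x)
        (PiTensorProduct.singleAlgHom (R := F) (A := B) j y) :=
    fun i j hij x y => commute_singleAlgHom (B := B) hij x y
  refine isEmpty_algEquiv_iSup_range_of_maximal δ hs hA n hn
    (fun i => PiTensorProduct.singleAlgHom (R := F) (A := B) i) hcomm _ ?_
  rw [algebraTensorProduct]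

/-- The algebra is realized by operators on any space of countable dimension. -/
lemma exists_locallyMatrix_not_tensorProduct (δ : Module.Basis ℕ F V) (hs : s.IsInfinite) :
    ∃ (A : Type w) (_ : Ring A) (_ : Algebra F A),
      IsLocallyMatrixAlgebra F A ∧ steinitzNumberOf F A = s ∧
        ∀ (ι : Type v) (n : ι → ℕ), (∀ i, 0 < n i) →
          IsEmpty (A ≃ₐ[F] algebraTensorProduct F fun i => Matrix (Fin (n i)) (Fin (n i)) F) := by
  obtain ⟨A, hA⟩ := exists_maximal_isSteinitzExtension (isSteinitzExtension_blockAlgebra δ (s := s))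
  have hnt : Nontrivial V := ⟨δ 0, 0, δ.ne_zero 0⟩
  exact ⟨A, inferInstance, inferInstance, hA.prop.isLocallyMatrix.isLocallyMatrixAlgebra,
    hA.prop.steinitzNumberOf_eq δ, fun ι n hn =>
      isEmpty_algEquiv_algebraTensorProduct_of_maximal δ hs hA n hn⟩

end TensorProducts

theorem theorem4 (F : Type u) [Field F] (s : SteinitzNumber) (hs : s.IsInfinite) :
    ∃ (A : Type u) (_ : Ring A) (_ : Algebra F A),
      IsLocallyMatrixAlgebra F A ∧ steinitzNumberOf F A = s ∧
        ∀ (ι : Type v) (n : ι → ℕ), (∀ i, 0 < n i) →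
          IsEmpty (A ≃ₐ[F] algebraTensorProduct F fun i => Matrix (Fin (n i)) (Fin (n i)) F) :=
  exists_locallyMatrix_not_tensorProduct Finsupp.basisSingleOne hs
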